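/- Write $\hat f$ for the $L^2$ Fourier transform, $\hat f(\xi)=\int_{\mathbb R} f(x)e^{-2\pi i x\xi}\,dx$. A multiresolution analysis (MRA) is a sequence of closed subspaces $V_j$, $j\in\mathbb Z$, of $L^2(\mathbb R)$ (complex-valued functions) such that $V_j\subseteq V_{j+1}$ for all $j$; $f(x)\in V_j \iff f(2x)\in V_{j+1}$ for all $j$; $\bigcap_j V_j=\{0\}$; $\overline{\bigcup_j V_j}=L^2(\mathbb R)$; and there is a $\varphi\in V_0$, called a scaling function, such that $\{\varphi(x-k):k\in\mathbb Z\}$ is an orthonormal basis of $V_0$. The low-pass filter associated with a scaling function $\varphi$ is the ($1$-periodic, square integrable on $[0,1]$) function $m_0(\xi)=\frac1{\sqrt2}\sum_{k\in\mathbb Z}\alpha_k e^{-2\pi i k\xi}$, where $\frac1{\sqrt2}\varphi(\frac x2)=\sum_{k\in\mathbb Z}\alpha_k\varphi(x-k)$ in $L^2(\mathbb R)$; this is the normalization for which $\hat\varphi(2\xi)=\hat\varphi(\xi)m_0(\xi)$ a.e. A function $\psi\in L^2(\mathbb R)$ is an orthonormal wavelet if $\{2^{j/2}\psi(2^jx-k):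 j,k\in\mathbb Z\}$ is an orthonormal basis of $L^2(\mathbb R)$. \textbf{Proposition 14.} Suppose $\varphi$ is a scaling function for an MRA $(V_j)_{j\in\mathbb Z}$ and $m_0$ is the associated low-pass filter. Then a function $\psi\in W_0=V_1\cap V_0^{\perp}$ is an orthonormal wavelet for $L^2(\mathbb R)$ if and only if $$\hat\psi(2\xi)=e^{2\pi i\xi}\,\nu(2\xi)\,\overline{m_0(\xi+1/2)}\,\hat\varphi(\xi)\quad\text{for a.e. }\xi\in\mathbb R,$$ for some $1$-periodic, measurable, a.e. unimodular function $\nu\in L^2[0,1]$. In particular, taking $\nu\equiv1$, there is a $\psi\in W_0$ with $\hat\psi(2\xi)=e^{2\pi i\xi}\,\overline{m_0(\xi+1/2)}\,\hat\varphi(\xi)$ a.e., and this $\psi$ is an orthonormal wavelet for $L^2(\mathbb R)$. -/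

import Mathlib

open MeasureTheory Filter Topology
open scoped FourierTransform ENNReal ComplexConjugate

noncomputable section

namespace MRAWavelet

/-- The complex Hilbert space `L²(ℝ)`. -/
abbrev L2R : Type := Lp ℂ 2 (volume : Measure ℝ)

/-- `x ↦ f (2 ^ j * x - k)` is square integrable when `f` is. -/
theorem memLp_dyadic (f : L2R) (j k : ℤ) :
    MemLp (fun x : ℝ => f ((2 : ℝ) ^ j * x - (k : ℝ))) 2 volume := by
  have h2 : ((2 : ℝ) ^ j) ≠ 0 := by positivity
  have hf : MemLp (fun y : ℝ => f (y - (k : ℝ))) 2 volume :=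
    (Lp.memLp f).comp_measurePreserving (measurePreserving_sub_right volume (k : ℝ))
  have hm : MemLp (fun y : ℝ => f (y - (k : ℝ))) 2
      (Measure.map (fun x : ℝ => (2 : ℝ) ^ j * x) volume) := by
    rw [Real.map_volume_mul_left h2]
    exact hf.smul_measure ENNReal.ofReal_ne_top
  exact hm.comp_of_map (by fun_prop)

/-- The element `x ↦ f (2 ^ j x - k)` of `L²(ℝ)` (no normalising factor). -/
def dyadic (f : L2R) (j k : ℤ) : L2R := (memLp_dyadic f j k).toLp _

/-- `v` is an orthonormal basis (in the Hilbert space sense) of the closed subspace `S`. -/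
def IsOrthonormalBasisOf {ι : Type*} (v : ι → L2R) (S : Submodule ℂ L2R) : Prop :=
  Orthonormal ℂ v ∧ (Submodule.span ℂ (Set.range v)).topologicalClosure = S

/-- `ψ` is an orthonormal wavelet: the functions `ψ_{j,k}(x) = 2^{j/2} ψ(2^j x - k)`, `j k : ℤ`,
form an orthonormal basis of `L²(ℝ)`. -/
def IsWavelet (ψ : L2R) : Prop :=
  IsOrthonormalBasisOf
    (fun p : ℤ × ℤ => (((2 : ℝ) ^ ((p.1 : ℝ) / 2) : ℝ) : ℂ) • dyadic ψ p.1 p.2) ⊤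

/-- `φ ∈ V₀` and the integer translates `φ(x - k)` form an orthonormal basis of `V₀`. -/
def IsScalingFunction (V : ℤ → Submodule ℂ L2R) (φ : L2R) : Prop :=
  φ ∈ V 0 ∧ IsOrthonormalBasisOf (fun k : ℤ => dyadic φ 0 k) (V 0)

/-- A multiresolution analysis of `L²(ℝ)`. -/
structure IsMRA (V : ℤ → Submodule ℂ L2R) : Prop where
  isClosed : ∀ j, IsClosed (V j : Set L2R)
  subset_succ : ∀ j, V j ≤ V (j + 1)
  /-- `f(x) ∈ V_j` if and only if `f(2x) ∈ V_{j+1}`. -/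
  dilation : ∀ j, ∀ f : L2R, f ∈ V j ↔ dyadic f 1 0 ∈ V (j + 1)
  iInter_eq : (⋂ j, (V j : Set L2R)) = {0}
  closure_iUnion_eq : closure (⋃ j, (V j : Set L2R)) = Set.univ
  exists_scaling : ∃ φ, IsScalingFunction V φ

/-- `m₀` is (a representative of) the low-pass filter of `φ`. If
`(1/√2) φ(x/2) = ∑ₖ αₖ φ(x - k)` in `L²(ℝ)`, then `m₀` is the 1-periodic function
`m₀(ξ) = (1/√2) ∑ₖ αₖ e^{-2πikξ}`, with convergence in `L²[0,1]`. This is the normalisation for which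
`φ̂(2ξ) = φ̂(ξ) m₀(ξ)`. -/
structure IsLowPassFilter (φ : L2R) (m₀ : ℝ → ℂ) : Prop where
  periodic : Function.Periodic m₀ 1
  memLp : MemLp m₀ 2 (volume.restrict (Set.Icc 0 1))
  exists_coeff : ∃ α : ℤ → ℂ,
    HasSum (fun k : ℤ => α k • dyadic φ 0 k) (((1 / √2 : ℝ) : ℂ) • dyadic φ (-1) 0) ∧
    Tendsto (fun s : Finset ℤ =>
        eLpNorm (fun ξ : ℝ => m₀ ξ - ((1 / √2 : ℝ) : ℂ) *
            ∑ k ∈ s, α k * Complex.exp (-2 * Real.pi * Complex.I * k * ξ)) 2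
          (volume.restrict (Set.Icc 0 1)))
      atTop (𝓝 0)

end MRAWavelet

end

open MRAWavelet

open MRAWavelet

noncomputable section

namespace MRAWavelet

open AddCircle

/-! ### Fourier coefficients on the circle and the half-period shift -/

section Circle

/-! On the Fourier side everything becomes an identity between functions on the circle.
Orthonormality of the translates of φ says that |φ̂|² dξ pushes forward to Haar measure
(`periodize_eq_haar`), so P ↦ P φ̂ is an isometry `circleMul` of L²(𝕋) into L²(ℝ). Its range is the
transform of V₀. By dilation, f ∈ V₁ exactly when f̂(2ξ) = P(ξ) φ̂(ξ) for some symbol P in L²(𝕋);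
the symbol of φ is M = m₀.

For f, g ∈ V₁ with symbols P, Q, inner products of translates of f with g are even Fourier
coefficients of conj P · Q. They are therefore governed by the bracket conj P · Q + (the same at x +
1/2), by `inner_modulate_iff`. Applied to φ this gives |M(x)|² + |M(x + 1/2)|² = 1. Orthogonality to
V₀ means that the bracket of M with the symbol A is zero, and linear algebra in ℂ² yields A(x) =
L(x) conj M(x + 1/2) with L(x + 1/2) = -L(x). The bracket of two such symbols is conj L₁ · L₂, so
the translates of ψ are orthonormal iff |L| = 1 a.e., and then they are automatically complete in W₀
(`isWavelet_iff_symbol`). The MRA axioms spread this over all scales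
(`isWavelet_of_orthonormal_of_complete`). Finally, anti-invariant L are precisely the functions
e^{2πiξ} ν(2ξ) with ν of period 1. -/

/-- Integration against an integrable density, as a functional on `C(𝕋)`. -/
def integralAgainst (ν : Measure UnitAddCircle) (q : UnitAddCircle → ℂ) (hq : Integrable q ν) :
    C(UnitAddCircle, ℂ) →L[ℂ] ℂ :=
  LinearMap.mkContinuous
    { toFun := fun f => ∫ x, f x * q x ∂ν
      map_add' := fun f g => by
        simp only [ContinuousMap.add_apply, add_mul]
        exact integral_add
          (hq.bdd_mul (c := ‖f‖) (by fun_prop) (Eventually.of_forall f.norm_coe_le_norm))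
          (hq.bdd_mul (c := ‖g‖) (by fun_prop) (Eventually.of_forall g.norm_coe_le_norm))
      map_smul' := fun c f => by
        simp only [ContinuousMap.smul_apply, smul_eq_mul, mul_assoc, RingHom.id_apply]
        exact integral_const_mul _ _ }
    (∫ x, ‖q x‖ ∂ν) (fun f => by
      simp only [LinearMap.coe_mk, AddHom.coe_mk]
      rw [mul_comm, ← integral_const_mul]
      refine norm_integral_le_of_norm_le (hq.norm.const_mul _) (Eventually.of_forall fun x => ?_)
      rw [norm_mul]
      gcongr
      exact f.norm_coe_le_norm x)

@[simp]
theorem integralAgainst_apply (ν : Measure UnitAddCircle) (q : UnitAddCircle → ℂ)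
    (hq : Integrable q ν) (f : C(UnitAddCircle, ℂ)) :
    integralAgainst ν q hq f = ∫ x, f x * q x ∂ν := rfl

theorem clm_ext_fourier {L M : C(UnitAddCircle, ℂ) →L[ℂ] ℂ}
    (h : ∀ n : ℤ, L (fourier n) = M (fourier n)) : L = M := by
  refine ContinuousLinearMap.ext_on (s := Set.range (@fourier 1)) ?_ ?_
  · exact Submodule.dense_iff_topologicalClosure_eq_top.2 span_fourier_closure_eq_top
  · rintro _ ⟨n, rfl⟩
    exact h n

/-- A finite measure on the circle is determined by its Fourier coefficients. -/
theorem measure_ext_fourier {ν₁ ν₂ : Measure UnitAddCircle} [IsFiniteMeasure ν₁]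
    [IsFiniteMeasure ν₂] (h : ∀ n : ℤ, ∫ x, fourier n x ∂ν₁ = ∫ x, fourier n x ∂ν₂) :
    ν₁ = ν₂ := by
  have key : integralAgainst ν₁ (fun _ => 1) (integrable_const _) =
      integralAgainst ν₂ (fun _ => 1) (integrable_const _) :=
    clm_ext_fourier fun n => by simpa using h n
  refine ext_of_forall_integral_eq_of_IsFiniteMeasure fun f => ?_
  have := DFunLike.congr_fun key ⟨fun x => (f x : ℂ), by fun_prop⟩
  simp only [integralAgainst_apply, ContinuousMap.coe_mk, mul_one] at this
  exact Complex.ofReal_injective ((integral_ofReal.symm.trans this).trans integral_ofReal)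

/-- An integrable function on the circle with vanishing Fourier coefficients vanishes a.e. -/
theorem ae_eq_zero_of_integral_fourier_mul_eq_zero {q : UnitAddCircle → ℂ}
    (hq : Integrable q haarAddCircle)
    (h : ∀ n : ℤ, ∫ x, fourier n x * q x ∂haarAddCircle = 0) : q =ᵐ[haarAddCircle] 0 := by
  have key : integralAgainst haarAddCircle q hq = 0 :=
    clm_ext_fourier fun n => by simpa using h n
  -- Closed sets suffice: their indicators are bounded pointwise limits of continuous functions,
  -- against which `q` integrates to zero.
  refine ae_eq_zero_of_forall_setIntegral_isClosed_eq_zero hq fun s hs => ?_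
  have hδ : Tendsto (fun n : ℕ => 1 / ((n : ℝ) + 1)) atTop (𝓝 0) :=
    tendsto_one_div_add_atTop_nhds_zero_nat
  have hpos : ∀ n : ℕ, 0 < 1 / ((n : ℝ) + 1) := fun n => Nat.one_div_pos_of_nat
  have hz : ∀ n : ℕ, ∫ x, ((thickenedIndicator (hpos n) s x : ℝ) : ℂ) * q x ∂haarAddCircle = 0 :=
    fun n => by
      have := DFunLike.congr_fun key
        ⟨fun x => ((thickenedIndicator (hpos n) s x : ℝ) : ℂ), by fun_prop⟩
      simpa using this
  have hlim : Tendsto (fun n : ℕ =>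
      ∫ x, ((thickenedIndicator (hpos n) s x : ℝ) : ℂ) * q x ∂haarAddCircle) atTop
      (𝓝 (∫ x, s.indicator q x ∂haarAddCircle)) := by
    refine tendsto_integral_of_dominated_convergence (fun x => ‖q x‖) (fun n => ?_) hq.norm
      (fun n => Eventually.of_forall fun x => ?_) (Eventually.of_forall fun x => ?_)
    · exact (Continuous.aestronglyMeasurable (by fun_prop)).mul hq.aestronglyMeasurable
    · rw [norm_mul]
      refine mul_le_of_le_one_left (norm_nonneg _) ?_
      have := thickenedIndicator_le_one (hpos n) s x
      simpa using this
    · have h1 := (tendsto_pi_nhds.1 (thickenedIndicator_tendsto_indicator_closure hpos hδ s)) x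
      rw [hs.closure_eq] at h1
      have h2 : Tendsto (fun n : ℕ => ((thickenedIndicator (hpos n) s x : ℝ) : ℂ) * q x) atTop
          (𝓝 (((s.indicator (fun _ => (1 : NNReal)) x : NNReal) : ℂ) * q x)) :=
        (((Complex.continuous_ofReal.comp NNReal.continuous_coe).tendsto _).comp h1).mul_const (q x)
      convert h2 using 2
      by_cases hx : x ∈ s <;> simp [hx]
  rw [← integral_indicator hs.measurableSet]
  exact tendsto_nhds_unique hlim (by simp only [hz, tendsto_const_nhds_iff])

/-- The half period, as a point of the circle. -/
def halfPeriod : UnitAddCircle := ((1 / 2 : ℝ) : UnitAddCircle)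

theorem halfPeriod_add_halfPeriod : halfPeriod + halfPeriod = 0 := by
  rw [halfPeriod, ← AddCircle.coe_add]
  norm_num

theorem fourier_halfPeriod (n : ℤ) : fourier n halfPeriod = (-1 : ℂ) ^ n := by
  rw [halfPeriod, fourier_coe_apply]
  rw [show 2 * (Real.pi : ℂ) * Complex.I * n * ((1 / 2 : ℝ) : ℂ) / ((1 : ℝ) : ℂ) =
    n * (Real.pi * Complex.I) by push_cast; ring, Complex.exp_int_mul, Complex.exp_pi_mul_I]

theorem fourier_add_halfPeriod (n : ℤ) (x : UnitAddCircle) :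
    fourier n (x + halfPeriod) = fourier n x * (-1 : ℂ) ^ n := by
  rw [← fourier_halfPeriod]
  simp [fourier_apply, smul_add, toCircle_add]

theorem measurePreserving_add_halfPeriod :
    MeasurePreserving (fun x : UnitAddCircle => x + halfPeriod) haarAddCircle haarAddCircle :=
  measurePreserving_add_right _ _

theorem integral_fourier_mul_shift (q : UnitAddCircle → ℂ) (n : ℤ) :
    ∫ x, fourier n x * q (x + halfPeriod) ∂haarAddCircle =
    (-1) ^ n * ∫ x, fourier n x * q x ∂haarAddCircle := by
  have := integral_add_right_eq_self (μ := haarAddCircle) (fun x => fourier n x * q x) halfPeriod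
  rw [← this, ← integral_const_mul]
  congr 1 with x
  rw [fourier_add_halfPeriod]
  have : ((-1 : ℂ) ^ n) * (-1) ^ n = 1 := by
    rw [← mul_zpow]; simp
  linear_combination (-fourier n x * q (x + halfPeriod)) * this

/-- If the even Fourier coefficients of `q` vanish, then `q` is anti-invariant under the half-period
shift. -/
theorem ae_add_shift_eq_zero {q : UnitAddCircle → ℂ} (hq : Integrable q haarAddCircle)
    (h : ∀ n : ℤ, ∫ x, fourier (2 * n) x * q x ∂haarAddCircle = 0) :
    ∀ᵐ x ∂haarAddCircle, q x + q (x + halfPeriod) = 0 := by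
  have hq' : Integrable (fun x => q (x + halfPeriod)) haarAddCircle :=
    measurePreserving_add_halfPeriod.integrable_comp_of_integrable hq
  refine ae_eq_zero_of_integral_fourier_mul_eq_zero (hq.add hq') fun n => ?_
  have hb : ∀ r : UnitAddCircle → ℂ, Integrable r haarAddCircle →
      Integrable (fun x => fourier n x * r x) haarAddCircle := fun r hr =>
    hr.bdd_mul (c := 1) (by fun_prop) (Eventually.of_forall fun x => ((fourier n).norm_coe_le_norm x).trans_eq (fourier_norm n))
  simp only [mul_add]
  rw [integral_add (hb _ hq) (hb _ hq'), integral_fourier_mul_shift]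
  -- Even coefficients vanish by hypothesis; odd ones cancel because the shift multiplies them by
  -- -1.
  rcases Int.even_or_odd' n with ⟨k, rfl | rfl⟩
  · rw [h k]; simp
  · rw [zpow_add₀ (by norm_num), zpow_mul]; norm_num

end Circle

/-! ### Dilations and translations on L²(ℝ) -/

section Dyadic

theorem quasiMeasurePreserving_affine {a : ℝ} (ha : a ≠ 0) (b : ℝ) :
    Measure.QuasiMeasurePreserving (fun x : ℝ => a * x - b) volume volume := by
  refine (measurePreserving_sub_right volume b).quasiMeasurePreserving.comp
    (f := fun x : ℝ => a * x) ⟨by fun_prop, ?_⟩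
  rw [Real.map_volume_mul_left ha]
  exact Measure.smul_absolutelyContinuous

theorem integral_comp_affine (F : ℝ → ℂ) (a b : ℝ) :
    ∫ x, F (a * x - b) = |a⁻¹| • ∫ x, F x := by
  rw [Measure.integral_comp_mul_left (fun x => F (x - b)), integral_sub_right_eq_self F b]

theorem coeFn_dyadic (f : L2R) (j k : ℤ) :
    dyadic f j k =ᵐ[volume] fun x => f ((2 : ℝ) ^ j * x - k) :=
  (memLp_dyadic f j k).coeFn_toLp

theorem dyadic_eq_of_ae {f g : L2R} {j k : ℤ} (h : g =ᵐ[volume] fun x => f ((2 : ℝ) ^ j * x - k)) :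
    dyadic f j k = g :=
  Lp.ext ((coeFn_dyadic f j k).trans h.symm)

theorem dyadic_congr_ae {f : L2R} {F : ℝ → ℂ} (h : f =ᵐ[volume] F) (j k : ℤ) :
    dyadic f j k =ᵐ[volume] fun x => F ((2 : ℝ) ^ j * x - k) :=
  (coeFn_dyadic f j k).trans
    ((quasiMeasurePreserving_affine (by positivity) _).ae_eq_comp h)

theorem dyadic_eq_of_coeFn {f g : L2R} {F G : ℝ → ℂ} {j k : ℤ} (hf : f =ᵐ[volume] F)
    (hg : g =ᵐ[volume] G) (h : ∀ x, G x = F ((2 : ℝ) ^ j * x - k)) : dyadic f j k = g :=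
  Lp.ext ((dyadic_congr_ae hf j k).trans
    (hg.trans (Eventually.of_forall h)).symm)

/-- For negative `j` the composite shift 2^j k' + k need not be an integer, so `m` is supplied with
a proof. -/
theorem dyadic_dyadic (f : L2R) (j k j' k' m : ℤ) (hm : (m : ℝ) = 2 ^ j * k' + k) :
    dyadic (dyadic f j k) j' k' = dyadic f (j + j') m := by
  refine Lp.ext ((dyadic_congr_ae (coeFn_dyadic f j k) j' k').trans
    ((coeFn_dyadic f _ m).trans (Eventually.of_forall fun x => ?_)).symm)
  simp only [hm, zpow_add₀ (two_ne_zero (α := ℝ))]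
  congr 1
  ring

@[simp]
theorem dyadic_zero_zero (f : L2R) : dyadic f 0 0 = f :=
  dyadic_eq_of_ae (Eventually.of_forall fun x => by simp)

/-- `f ↦ f (2 ^ j x - k)` as a linear map. -/
def dyadicₗ (j k : ℤ) : L2R →ₗ[ℂ] L2R where
  toFun f := dyadic f j k
  map_add' f g := by
    refine Lp.ext ((dyadic_congr_ae (Lp.coeFn_add f g) j k).trans ?_)
    filter_upwards [Lp.coeFn_add (dyadic f j k) (dyadic g j k), coeFn_dyadic f j k,
      coeFn_dyadic g j k] with x h1 h2 h3
    rw [h1, Pi.add_apply, Pi.add_apply, h2, h3]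
  map_smul' c f := by
    refine Lp.ext ((dyadic_congr_ae (Lp.coeFn_smul c f) j k).trans ?_)
    filter_upwards [Lp.coeFn_smul c (dyadic f j k), coeFn_dyadic f j k] with x h1 h2
    rw [RingHom.id_apply, h1, Pi.smul_apply, Pi.smul_apply, h2]

theorem inner_dyadic (f g : L2R) (j k : ℤ) :
    inner ℂ (dyadic f j k) (dyadic g j k) = (((2 : ℝ) ^ (-j) : ℝ) : ℂ) * inner ℂ f g := by
  simp only [L2.inner_def]
  rw [integral_congr_ae (g := fun x => (fun y => inner ℂ (f y) (g y)) ((2 : ℝ) ^ j * x - k)),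
    integral_comp_affine (fun y => inner ℂ (f y) (g y)), abs_of_pos (by positivity), zpow_neg, Complex.real_smul]
  filter_upwards [coeFn_dyadic f j k, coeFn_dyadic g j k] with x h1 h2
  simp [h1, h2]

theorem norm_dyadic (f : L2R) (j k : ℤ) : ‖dyadic f j k‖ = √((2 : ℝ) ^ (-j)) * ‖f‖ := by
  have h := inner_dyadic f f j k
  rw [inner_self_eq_norm_sq_to_K, inner_self_eq_norm_sq_to_K] at h
  have h' : ‖dyadic f j k‖ ^ 2 = (2 : ℝ) ^ (-j) * ‖f‖ ^ 2 := by
    apply Complex.ofReal_injective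
    push_cast
    simpa using h
  rw [← Real.sqrt_sq (norm_nonneg (dyadic f j k)), h', Real.sqrt_mul (by positivity),
    Real.sqrt_sq (norm_nonneg f)]

theorem continuous_dyadic (j k : ℤ) : Continuous fun f : L2R => dyadic f j k :=
  ((dyadicₗ j k).mkContinuous _ fun f => (norm_dyadic f j k).le).continuous

end Dyadic

/-! ### Fourier transform of translates and dilates -/

section Fourier

theorem norm_fourier_apply (n : ℤ) (x : UnitAddCircle) : ‖(fourier n x : ℂ)‖ = 1 := by
  rw [fourier_apply]
  exact Circle.norm_coe _

theorem memLp_fourier_mul (n : ℤ) (f : L2R) :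
    MemLp (fun ξ : ℝ => fourier n (ξ : UnitAddCircle) * f ξ) 2 volume := by
  refine (Lp.memLp f).of_le ?_ (Eventually.of_forall fun ξ => ?_)
  · exact (Continuous.aestronglyMeasurable
      ((fourier n).continuous.comp (AddCircle.continuous_mk' 1))).mul
      (Lp.aestronglyMeasurable f)
  · rw [norm_mul, norm_fourier_apply, one_mul]

/-- Multiplication by the character `ξ ↦ e^{2πinξ}` on `L²(ℝ)`. -/
def modulate (n : ℤ) : L2R →ₗᵢ[ℂ] L2R where
  toFun f := (memLp_fourier_mul n f).toLp
  map_add' f g := by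
    refine Lp.ext ((memLp_fourier_mul n (f + g)).coeFn_toLp.trans ?_)
    filter_upwards [Lp.coeFn_add ((memLp_fourier_mul n f).toLp) ((memLp_fourier_mul n g).toLp),
      (memLp_fourier_mul n f).coeFn_toLp, (memLp_fourier_mul n g).coeFn_toLp,
      Lp.coeFn_add f g] with x h1 h2 h3 h4
    simp only [h1, h2, h3, h4, Pi.add_apply, mul_add]
  map_smul' c f := by
    refine Lp.ext ((memLp_fourier_mul n (c • f)).coeFn_toLp.trans ?_)
    filter_upwards [Lp.coeFn_smul c ((memLp_fourier_mul n f).toLp),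
      (memLp_fourier_mul n f).coeFn_toLp, Lp.coeFn_smul c f] with x h1 h2 h4
    simp only [h1, h2, h4, Pi.smul_apply, smul_eq_mul, RingHom.id_apply]
    ring
  norm_map' f := by
    simp only [LinearMap.coe_mk, AddHom.coe_mk, Lp.norm_toLp]
    rw [Lp.norm_def]
    congr 1
    refine eLpNorm_congr_norm_ae (Eventually.of_forall fun ξ => ?_)
    rw [norm_mul, norm_fourier_apply, one_mul]

theorem coeFn_modulate (n : ℤ) (f : L2R) :
    modulate n f =ᵐ[volume] fun ξ : ℝ => fourier n (ξ : UnitAddCircle) * f ξ :=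
  (memLp_fourier_mul n f).coeFn_toLp

theorem induction_schwartz {p : L2R → Prop} (hp : IsClosed {f | p f})
    (h : ∀ f : SchwartzMap ℝ ℂ, p (f.toLp 2 volume)) (f : L2R) : p f :=
  (SchwartzMap.denseRange_toLpCLM (F := ℂ) (E := ℝ) (μ := volume) (p := 2)
    ENNReal.ofNat_ne_top).induction_on f hp h

theorem continuous_fourier_L2 : Continuous fun f : L2R => (𝓕 f : L2R) :=
  (Lp.fourierTransformₗᵢ ℝ ℂ).continuous

/-- The Fourier transform turns integer translations into modulations. -/
theorem fourier_dyadic_zero (f : L2R) (k : ℤ) : 𝓕 (dyadic f 0 k) = modulate (-k) (𝓕 f) := by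
  -- Both sides are continuous in `f`, so Schwartz functions suffice; there the transform is an
  -- integral and a substitution proves the identity.
  refine induction_schwartz (p := fun f => 𝓕 (dyadic f 0 k) = modulate (-k) (𝓕 f))
    (isClosed_eq ?_ ?_) (fun f => ?_) f
  · exact continuous_fourier_L2.comp (continuous_dyadic 0 k)
  · exact (modulate (-k)).continuous.comp continuous_fourier_L2
  let g : SchwartzMap ℝ ℂ := f.compSubConstCLM ℂ (k : ℝ)
  have hg : ∀ x, g x = f (x - k) := fun x => rfl
  have h1 : dyadic (f.toLp 2 volume) 0 k = g.toLp 2 volume := by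
    refine dyadic_eq_of_coeFn (f.coeFn_toLp 2 volume) (g.coeFn_toLp 2 volume) fun x => ?_
    rw [hg]
    simp
  rw [h1, SchwartzMap.toLp_fourier_eq, SchwartzMap.toLp_fourier_eq]
  refine Lp.ext (((𝓕 g).coeFn_toLp 2 volume).trans ?_)
  filter_upwards [coeFn_modulate (-k) ((𝓕 f).toLp 2 volume), (𝓕 f).coeFn_toLp 2 volume] with ξ h2 h3
  rw [h2, h3, SchwartzMap.fourier_coe, SchwartzMap.fourier_coe,
    Real.fourier_real_eq_integral_exp_smul, Real.fourier_real_eq_integral_exp_smul,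
    ← integral_const_mul, eq_comm, ← integral_sub_right_eq_self _ (k : ℝ)]
  congr 1 with x
  simp only [hg, smul_eq_mul, fourier_coe_apply, ← mul_assoc,
    ← Complex.exp_add]
  congr 2
  push_cast
  ring

/-- The Fourier transform turns a dilation into the inverse dilation. -/
theorem fourier_dyadic_neg_one (f : L2R) : 𝓕 (dyadic f (-1) 0) = (2 : ℂ) • dyadic (𝓕 f) 1 0 := by
  refine induction_schwartz (p := fun f => 𝓕 (dyadic f (-1) 0) = (2 : ℂ) • dyadic (𝓕 f) 1 0)
    (isClosed_eq ?_ ?_) (fun f => ?_) f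
  · exact continuous_fourier_L2.comp (continuous_dyadic (-1) 0)
  · exact ((continuous_dyadic 1 0).comp continuous_fourier_L2).const_smul (2 : ℂ)
  let g : SchwartzMap ℝ ℂ := SchwartzMap.compCLMOfContinuousLinearEquiv ℂ
    (ContinuousLinearEquiv.unitsEquivAut ℝ (Units.mk0 (1 / 2) (by norm_num))) f
  have hg : ∀ x, g x = f (x * (1 / 2)) := fun x => rfl
  have h1 : dyadic (f.toLp 2 volume) (-1) 0 = g.toLp 2 volume := by
    refine dyadic_eq_of_coeFn (f.coeFn_toLp 2 volume) (g.coeFn_toLp 2 volume) fun x => ?_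
    rw [hg, mul_comm]
    simp
  rw [h1, SchwartzMap.toLp_fourier_eq, SchwartzMap.toLp_fourier_eq]
  refine Lp.ext (((𝓕 g).coeFn_toLp 2 volume).trans ?_)
  filter_upwards [Lp.coeFn_smul (2 : ℂ) (dyadic ((𝓕 f).toLp 2 volume) 1 0),
    dyadic_congr_ae ((𝓕 f).coeFn_toLp 2 volume) 1 0] with ξ h2 h3
  rw [h2, Pi.smul_apply, h3, SchwartzMap.fourier_coe, SchwartzMap.fourier_coe,
    Real.fourier_real_eq_integral_exp_smul, Real.fourier_real_eq_integral_exp_smul]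
  have := integral_comp_affine (fun v => Complex.exp (((-2 * Real.pi * v * (2 * ξ) : ℝ) : ℂ) *
    Complex.I) • f v) (1 / 2) 0
  have h4 : ((2 : ℝ) ^ (1 : ℤ) * ξ - ((0 : ℤ) : ℝ)) = 2 * ξ := by simp
  rw [h4, show ∀ z : ℂ, (2 : ℂ) • z = |((1 / 2 : ℝ))⁻¹| • z by
    intro z; rw [Complex.real_smul]; norm_num, ← this]
  congr 1 with x
  rw [hg]
  congr 2
  · congr 2
    ring
  · ring

end Fourier

/-! ### Passing between the line and the circle -/

section Covering

theorem measurePreserving_coe_Ioc (t : ℝ) :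
    MeasurePreserving ((↑) : ℝ → UnitAddCircle) (volume.restrict (Set.Ioc t (t + 1)))
      haarAddCircle := by
  have := AddCircle.measurePreserving_mk 1 t
  rwa [volume_eq_smul_haarAddCircle, ENNReal.ofReal_one, one_smul] at this

theorem quasiMeasurePreserving_coe :
    Measure.QuasiMeasurePreserving ((↑) : ℝ → UnitAddCircle) volume haarAddCircle := by
  refine ⟨AddCircle.measurable_mk', Measure.AbsolutelyContinuous.mk fun s hs h => ?_⟩
  rw [Measure.map_apply AddCircle.measurable_mk' hs]
  have hcov : ((↑) : ℝ → UnitAddCircle) ⁻¹' s ⊆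
      ⋃ n : ℤ, ((↑) : ℝ → UnitAddCircle) ⁻¹' s ∩ Set.Ioc (n : ℝ) (n + 1) := by
    rw [← Set.inter_iUnion, iUnion_Ioc_intCast, Set.inter_univ]
  refine measure_mono_null hcov (measure_iUnion_null fun n => ?_)
  rw [← Measure.restrict_apply (AddCircle.measurable_mk' hs),
    (measurePreserving_coe_Ioc n).measure_preimage hs.nullMeasurableSet, h]

theorem ae_coe_of_ae {p : UnitAddCircle → Prop} (h : ∀ᵐ x ∂haarAddCircle, p x) :
    ∀ᵐ ξ : ℝ, p (ξ : UnitAddCircle) :=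
  quasiMeasurePreserving_coe.ae h

/-- The section of the covering map with values in (0, 1] preserves measure, so null sets pull back
along it. -/
theorem ae_of_ae_coe {p : UnitAddCircle → Prop} (h : ∀ᵐ ξ : ℝ, p (ξ : UnitAddCircle)) :
    ∀ᵐ x ∂haarAddCircle, p x := by
  have hm : MeasurePreserving (fun x : UnitAddCircle => (equivIoc 1 0 x : ℝ)) volume
      (volume.restrict (Set.Ioc (0 : ℝ) (0 + 1))) :=
    (measurePreserving_subtype_coe measurableSet_Ioc).comp
      (AddCircle.measurePreserving_equivIoc 1)
  have h1 := hm.quasiMeasurePreserving.ae (ae_restrict_of_ae h)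
  rw [volume_eq_smul_haarAddCircle, ENNReal.ofReal_one, one_smul] at h1
  filter_upwards [h1] with x hx
  rwa [AddCircle.coe_equivIoc] at hx

/-- A `1`-periodic function, square integrable over a period, descends to `L²` of the circle. -/
theorem exists_circle_of_periodic {m : ℝ → ℂ} (hp : Function.Periodic m 1)
    (hm : MemLp m 2 (volume.restrict (Set.Icc 0 1))) :
    ∃ M : UnitAddCircle → ℂ, MemLp M 2 haarAddCircle ∧ ∀ ξ : ℝ, M ξ = m ξ := by
  have hm' : MemLp m 2 (volume.restrict (Set.Ioc 0 (0 + 1))) := by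
    rwa [zero_add, restrict_Ioc_eq_restrict_Icc]
  refine ⟨liftIoc 1 0 m, hm'.memLp_liftIoc.haarAddCircle, fun ξ => ?_⟩
  have h : ((equivIoc 1 0 (ξ : UnitAddCircle) : ℝ) : UnitAddCircle) = ξ := coe_equivIoc
  have := congrArg hp.lift h
  rwa [hp.lift_coe, hp.lift_coe] at this

end Covering

/-! ### Symbols: multiplying a fixed function by L²(𝕋) -/

section CircleMul

/-- `L²` of the circle. -/
abbrev L2Circle : Type := Lp ℂ 2 (haarAddCircle : Measure UnitAddCircle)

variable (ϕ : L2R)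

/-- The image on the circle of the measure `|ϕ|² dξ`. -/
def periodize : Measure UnitAddCircle :=
  (volume.withDensity fun ξ : ℝ => ((‖ϕ ξ‖₊ ^ 2 : NNReal) : ℝ≥0∞)).map (↑)

theorem aemeasurable_nnnorm_sq : AEMeasurable (fun ξ : ℝ => ‖ϕ ξ‖₊ ^ 2) volume :=
  (Lp.aestronglyMeasurable ϕ).aemeasurable.nnnorm.pow_const 2

instance : IsFiniteMeasure (periodize ϕ) := by
  have : IsFiniteMeasure
      (volume.withDensity fun ξ : ℝ => ((‖ϕ ξ‖₊ ^ 2 : NNReal) : ℝ≥0∞)) := by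
    refine isFiniteMeasure_withDensity ?_
    have := (Lp.memLp ϕ).eLpNorm_lt_top
    rw [eLpNorm_lt_top_iff_lintegral_rpow_enorm_lt_top two_ne_zero ENNReal.ofNat_ne_top] at this
    convert this.ne using 3 with ξ
    simp [enorm]
  exact Measure.isFiniteMeasure_map _ _

theorem integral_periodize {F : UnitAddCircle → ℂ} (hF : AEStronglyMeasurable F (periodize ϕ)) :
    ∫ x, F x ∂periodize ϕ = ∫ ξ : ℝ, ((‖ϕ ξ‖ ^ 2 : ℝ) : ℂ) * F ξ := by
  rw [periodize, integral_map (AddCircle.measurable_mk'.aemeasurable) hF,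
    integral_withDensity_eq_integral_smul₀ (aemeasurable_nnnorm_sq ϕ)]
  congr 1

theorem lintegral_periodize {F : UnitAddCircle → ℝ≥0∞} (hF : AEMeasurable F (periodize ϕ)) :
    ∫⁻ x, F x ∂periodize ϕ = ∫⁻ ξ : ℝ, ‖ϕ ξ‖ₑ ^ 2 * F ξ := by
  have hq : AEMeasurable (fun ξ : ℝ => F ξ)
      (volume.withDensity fun ξ : ℝ => ((‖ϕ ξ‖₊ ^ 2 : NNReal) : ℝ≥0∞)) :=
    hF.comp_measurable AddCircle.measurable_mk'
  rw [periodize, lintegral_map' hF (AddCircle.measurable_mk'.aemeasurable),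
    lintegral_withDensity_eq_lintegral_mul₀' (aemeasurable_nnnorm_sq ϕ).coe_nnreal_ennreal hq]
  congr 1

variable {ϕ}

theorem inner_modulate_self (n : ℤ) :
    inner ℂ (modulate n ϕ) ϕ = ∫ x, fourier (-n) x ∂periodize ϕ := by
  rw [integral_periodize ϕ (by fun_prop), L2.inner_def]
  refine integral_congr_ae ?_
  filter_upwards [coeFn_modulate n ϕ] with ξ h
  rw [h, RCLike.inner_apply, map_mul, fourier_neg]
  have : ϕ ξ * conj (ϕ ξ) = ((‖ϕ ξ‖ ^ 2 : ℝ) : ℂ) := by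
    rw [Complex.mul_conj, Complex.normSq_eq_norm_sq]
  rw [← this]
  ring

theorem integral_fourier (n : ℤ) :
    ∫ x, (fourier n x : ℂ) ∂(haarAddCircle : Measure UnitAddCircle) = if n = 0 then 1 else 0 := by
  have := orthonormal_iff_ite.1 (orthonormal_fourier (T := 1)) 0 n
  rw [L2.inner_def] at this
  rw [show (if n = 0 then (1 : ℂ) else 0) = if 0 = n then 1 else 0 by simp only [eq_comm], ← this]
  refine integral_congr_ae ?_
  filter_upwards [coeFn_fourierLp (T := 1) 2 0, coeFn_fourierLp (T := 1) 2 n] with x h1 h2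
  rw [h1, h2]
  simp

theorem integrable_fourier_mul {q : UnitAddCircle → ℂ} (hq : Integrable q haarAddCircle) (n : ℤ) :
    Integrable (fun x => fourier n x * q x) haarAddCircle :=
  hq.bdd_mul (c := 1) (by fun_prop) (Eventually.of_forall fun x => (norm_fourier_apply n x).le)

/-- The even Fourier coefficients of `q` are those of the constant `c / 2` if and only if
`q(x) + q(x + 1/2) = c` a.e. -/
theorem two_mul_integral_fourier_even_iff {q : UnitAddCircle → ℂ}
    (hq : Integrable q haarAddCircle) (c : ℂ) :
    (∀ n : ℤ, 2 * ∫ x, fourier (2 * n) x * q x ∂haarAddCircle = if n = 0 then c else 0) ↔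
      ∀ᵐ x ∂haarAddCircle, q x + q (x + halfPeriod) = c := by
  have hI : ∀ n : ℤ, (if 2 * n = 0 then (1 : ℂ) else 0) = if n = 0 then 1 else 0 := fun n => by
    simp
  constructor
  · intro H
    have hc : Integrable (fun x => q x - c / 2) haarAddCircle := hq.sub (integrable_const _)
    have hz : ∀ n : ℤ, ∫ x, fourier (2 * n) x * (q x - c / 2) ∂haarAddCircle = 0 := fun n => by
      simp only [mul_sub]
      rw [integral_sub (integrable_fourier_mul hq _)
        (integrable_fourier_mul (integrable_const _) _), integral_mul_const, integral_fourier, hI]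
      have h1 := H n
      split_ifs at h1 ⊢ <;> linear_combination (1 / 2) * h1
    filter_upwards [ae_add_shift_eq_zero hc hz] with x hx
    linear_combination hx
  · intro hae n
    have hq' : Integrable (fun x => q (x + halfPeriod)) haarAddCircle :=
      measurePreserving_add_halfPeriod.integrable_comp_of_integrable hq
    have hs := integral_fourier_mul_shift q (2 * n)
    rw [(even_two_mul n).neg_one_zpow, one_mul] at hs
    have hsum : ∫ x, fourier (2 * n) x * (q x + q (x + halfPeriod)) ∂haarAddCircle =
        ∫ x, fourier (2 * n) x * c ∂(haarAddCircle : Measure UnitAddCircle) := by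
      refine integral_congr_ae ?_
      filter_upwards [hae] with x hx
      rw [← hx]
    simp only [mul_add] at hsum
    rw [integral_add (integrable_fourier_mul hq _) (integrable_fourier_mul hq' _), hs,
      integral_mul_const, integral_fourier, hI] at hsum
    rw [two_mul, hsum]
    split_ifs <;> simp

/-- Orthonormality of the modulates of `ϕ` says that `|ϕ|²` periodizes to `1`. -/
theorem periodize_eq_haar (h : ∀ n : ℤ, inner ℂ (modulate n ϕ) ϕ = if n = 0 then 1 else 0) :
    periodize ϕ = haarAddCircle := by
  refine measure_ext_fourier fun n => ?_
  rw [integral_fourier, ← neg_neg n, ← inner_modulate_self, h]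
  simp

theorem memLp_circleMul (h : periodize ϕ = haarAddCircle)
    (P : L2Circle) :
    MemLp (fun ξ : ℝ => P (ξ : UnitAddCircle) * ϕ ξ) 2 volume ∧
      eLpNorm (fun ξ : ℝ => P (ξ : UnitAddCircle) * ϕ ξ) 2 volume =
        eLpNorm P 2 haarAddCircle := by
  have hn : eLpNorm (fun ξ : ℝ => P (ξ : UnitAddCircle) * ϕ ξ) 2 volume =
      eLpNorm P 2 haarAddCircle := by
    rw [eLpNorm_eq_lintegral_rpow_enorm_toReal two_ne_zero ENNReal.ofNat_ne_top,
      eLpNorm_eq_lintegral_rpow_enorm_toReal two_ne_zero ENNReal.ofNat_ne_top]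
    congr 1
    have := lintegral_periodize ϕ (F := fun x => ‖P x‖ₑ ^ (2 : ℝ))
      ((Lp.stronglyMeasurable P).measurable.enorm.pow_const _).aemeasurable
    rw [h] at this
    simp only [ENNReal.toReal_ofNat]
    rw [this]
    congr 1 with ξ
    rw [enorm_mul, ENNReal.mul_rpow_of_nonneg _ _ (by norm_num), mul_comm]
    norm_num
  refine ⟨⟨?_, ?_⟩, hn⟩
  · exact ((Lp.stronglyMeasurable P).comp_measurable AddCircle.measurable_mk').aestronglyMeasurable.mul
      (Lp.aestronglyMeasurable ϕ)
  · rw [hn]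
    exact Lp.eLpNorm_lt_top P

variable (h : periodize ϕ = haarAddCircle)

/-- The isometry `P ↦ P ϕ` from `L²` of the circle to `L²(ℝ)`. -/
def circleMul : L2Circle →ₗᵢ[ℂ] L2R where
  toFun P := (memLp_circleMul h P).1.toLp
  map_add' P Q := by
    refine Lp.ext ((memLp_circleMul h (P + Q)).1.coeFn_toLp.trans ?_)
    filter_upwards [Lp.coeFn_add ((memLp_circleMul h P).1.toLp) ((memLp_circleMul h Q).1.toLp),
      (memLp_circleMul h P).1.coeFn_toLp, (memLp_circleMul h Q).1.coeFn_toLp,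
      ae_coe_of_ae (Lp.coeFn_add P Q)] with x h1 h2 h3 h4
    simp only [h1, h2, h3, h4, Pi.add_apply, add_mul]
  map_smul' c P := by
    refine Lp.ext ((memLp_circleMul h (c • P)).1.coeFn_toLp.trans ?_)
    filter_upwards [Lp.coeFn_smul c ((memLp_circleMul h P).1.toLp),
      (memLp_circleMul h P).1.coeFn_toLp, ae_coe_of_ae (Lp.coeFn_smul c P)] with x h1 h2 h4
    simp only [h1, h2, h4, Pi.smul_apply, smul_eq_mul, RingHom.id_apply, mul_assoc]
  norm_map' P := by
    simp only [LinearMap.coe_mk, AddHom.coe_mk, Lp.norm_toLp]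
    rw [Lp.norm_def, (memLp_circleMul h P).2]

theorem coeFn_circleMul {P : L2Circle}
    {F : UnitAddCircle → ℂ} (hF : P =ᵐ[haarAddCircle] F) :
    circleMul h P =ᵐ[volume] fun ξ : ℝ => F ξ * ϕ ξ := by
  filter_upwards [(memLp_circleMul h P).1.coeFn_toLp, ae_coe_of_ae hF] with ξ h1 h2
  rw [← h2]
  exact h1

theorem circleMul_fourierLp (n : ℤ) : circleMul h (fourierLp 2 n) = modulate n ϕ :=
  Lp.ext ((coeFn_circleMul h (coeFn_fourierLp 2 n)).trans (coeFn_modulate n ϕ).symm)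

theorem inner_modulate_circleMul (n : ℤ)
    (P Q : L2Circle) :
    inner ℂ (modulate n (circleMul h P)) (circleMul h Q) =
      ∫ x, fourier (-n) x * (conj (P x) * Q x) ∂haarAddCircle := by
  have hm : AEStronglyMeasurable (fun x => fourier (-n) x * (conj (P x) * Q x))
      (haarAddCircle : Measure UnitAddCircle) := by
    have h1 := (Complex.continuous_conj.comp_stronglyMeasurable (Lp.stronglyMeasurable P)).mul
      (Lp.stronglyMeasurable Q)
    exact ((fourier (-n)).continuous.stronglyMeasurable.mul h1).aestronglyMeasurable
  have := integral_periodize ϕ (F := fun x => fourier (-n) x * (conj (P x) * Q x)) (by rwa [h])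
  rw [h] at this
  rw [this, L2.inner_def]
  refine integral_congr_ae ?_
  filter_upwards [coeFn_modulate n (circleMul h P), coeFn_circleMul h (ae_eq_refl P),
    coeFn_circleMul h (ae_eq_refl Q)] with ξ h1 h2 h3
  rw [h1, h2, h3, RCLike.inner_apply, map_mul, map_mul, fourier_neg]
  have : ϕ ξ * conj (ϕ ξ) = ((‖ϕ ξ‖ ^ 2 : ℝ) : ℂ) := by
    rw [Complex.mul_conj, Complex.normSq_eq_norm_sq]
  rw [← this]
  ring

/-- This doubling of frequency is why only even Fourier coefficients enter the Gram computations. -/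
theorem dyadic_modulate (n : ℤ) (f : L2R) :
    dyadic (modulate n f) 1 0 = modulate (2 * n) (dyadic f 1 0) := by
  refine Lp.ext ((dyadic_congr_ae (coeFn_modulate n f) 1 0).trans ?_)
  filter_upwards [coeFn_modulate (2 * n) (dyadic f 1 0), coeFn_dyadic f 1 0] with ξ h1 h2
  rw [h1, h2]
  congr 1
  rw [fourier_coe_apply, fourier_coe_apply]
  congr 1
  push_cast
  simp
  ring

theorem integrable_conj_mul (P Q : L2Circle) :
    Integrable (fun x => conj (P x) * Q x) haarAddCircle := by
  have := L2.integrable_inner (𝕜 := ℂ) P Q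
  refine this.congr (Eventually.of_forall fun x => ?_)
  simp [mul_comm]

/-- The factor 2 undoes the Jacobian 1/2 of the dilation ξ ↦ 2ξ. -/
theorem inner_modulate_eq {f g : L2R} {P Q : L2Circle}
    (hP : dyadic f 1 0 = circleMul h P) (hQ : dyadic g 1 0 = circleMul h Q) (n : ℤ) :
    inner ℂ (modulate n f) g =
      2 * ∫ x, fourier (-(2 * n)) x * (conj (P x) * Q x) ∂haarAddCircle := by
  have := inner_dyadic (modulate n f) g 1 0
  rw [dyadic_modulate, hP, hQ, inner_modulate_circleMul] at this
  rw [this, ← mul_assoc]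
  norm_num

/-- The Gram coefficients of the modulates of `f` against `g`, read off from the symbols of `f` and
`g`. -/
theorem inner_modulate_iff {f g : L2R} {P Q : L2Circle}
    (hP : dyadic f 1 0 = circleMul h P) (hQ : dyadic g 1 0 = circleMul h Q) (c : ℂ) :
    (∀ n : ℤ, inner ℂ (modulate n f) g = if n = 0 then c else 0) ↔
      ∀ᵐ x ∂haarAddCircle, conj (P x) * Q x + conj (P (x + halfPeriod)) * Q (x + halfPeriod) = c := by
  rw [← two_mul_integral_fourier_even_iff (integrable_conj_mul P Q) c]
  simp only [inner_modulate_eq h hP hQ]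
  refine ⟨fun H n => ?_, fun H n => ?_⟩
  · simpa using H (-n)
  · simpa using H (-n)

end CircleMul

/-! ### Geometry of the MRA: from one scale to all scales -/

section Hilbert

variable {V : ℤ → Submodule ℂ L2R}

theorem dyadic_cancel (f : L2R) (j : ℤ) : dyadic (dyadic f j 0) (-j) 0 = f := by
  rw [dyadic_dyadic f j 0 (-j) 0 0 (by simp), add_neg_cancel, dyadic_zero_zero]

theorem dyadic_cancel' (f : L2R) (j : ℤ) : dyadic (dyadic f (-j) 0) j 0 = f := by
  rw [dyadic_dyadic f (-j) 0 j 0 0 (by simp), neg_add_cancel, dyadic_zero_zero]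

theorem dyadic_comp (f : L2R) (i j : ℤ) : dyadic (dyadic f i 0) j 0 = dyadic f (i + j) 0 :=
  dyadic_dyadic f i 0 j 0 0 (by simp)

theorem dyadic_zero_dyadic (f : L2R) (j k : ℤ) : dyadic (dyadic f 0 k) j 0 = dyadic f j k := by
  rw [dyadic_dyadic f 0 k j 0 k (by simp), zero_add]

theorem IsMRA.dyadic_mem_iff (hV : IsMRA V) (f : L2R) (i j : ℤ) :
    dyadic f j 0 ∈ V (i + j) ↔ f ∈ V i := by
  induction j with
  | zero => simp
  | succ n ih =>
    rw [← ih, hV.dilation (i + n), dyadic_comp, add_assoc]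
  | pred n ih =>
    rw [← ih, show i + (-(n : ℤ) - 1) = i - n - 1 by ring, hV.dilation (i - n - 1), dyadic_comp,
      show i - (n : ℤ) - 1 + 1 = i + -n by ring, show -(n : ℤ) - 1 + 1 = -n by ring]

theorem IsScalingFunction.mem_of_forall {φ : L2R} (hφ : IsScalingFunction V φ)
    {S : Submodule ℂ L2R} (hS : IsClosed (S : Set L2R)) (h : ∀ k, dyadic φ 0 k ∈ S) : V 0 ≤ S := by
  rw [← hφ.2.2]
  refine Submodule.topologicalClosure_minimal _ (Submodule.span_le.2 ?_) hS
  rintro _ ⟨k, rfl⟩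
  exact h k

theorem IsScalingFunction.translate_mem (hV : IsMRA V) {φ : L2R} (hφ : IsScalingFunction V φ)
    (k : ℤ) {f : L2R} (hf : f ∈ V 0) : dyadic f 0 k ∈ V 0 := by
  refine hφ.mem_of_forall (S := (V 0).comap (dyadicₗ 0 k))
    ((hV.isClosed 0).preimage (continuous_dyadic 0 k)) (fun l => ?_) hf
  change dyadic (dyadic φ 0 l) 0 k ∈ V 0
  rw [dyadic_dyadic φ 0 l 0 k (k + l) (by simp), ← hφ.2.2]
  exact Submodule.le_topologicalClosure _ (Submodule.subset_span ⟨k + l, rfl⟩)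

theorem IsScalingFunction.mem_orthogonal_iff {φ : L2R} (hφ : IsScalingFunction V φ) (f : L2R) :
    f ∈ (V 0)ᗮ ↔ ∀ k, inner ℂ (dyadic φ 0 k) f = 0 := by
  constructor
  · intro hf k
    refine Submodule.inner_right_of_mem_orthogonal ?_ hf
    rw [← hφ.2.2]
    exact Submodule.le_topologicalClosure _ (Submodule.subset_span ⟨k, rfl⟩)
  · intro h
    have : V 0 ≤ (ℂ ∙ f)ᗮ := hφ.mem_of_forall (Submodule.isClosed_orthogonal _) fun k =>
      Submodule.mem_orthogonal_singleton_iff_inner_left.2 (h k)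
    exact (Submodule.mem_orthogonal _ _).2 fun u hu =>
      Submodule.mem_orthogonal_singleton_iff_inner_left.1 (this hu)

/-- Translating f by k is translating f(x/2), which lies in V₀, by 2k. For orthogonality, the
translation is moved onto φ, where it only reindexes. -/
theorem IsScalingFunction.translate_mem_wavelet (hV : IsMRA V) {φ : L2R}
    (hφ : IsScalingFunction V φ) (k : ℤ) {f : L2R} (hf : f ∈ V 1 ⊓ (V 0)ᗮ) :
    dyadic f 0 k ∈ V 1 ⊓ (V 0)ᗮ := by
  refine ⟨?_, ?_⟩
  · have h1 : dyadic f (-1) 0 ∈ V (1 + -1) := (hV.dyadic_mem_iff f 1 (-1)).2 hf.1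
    have h2 := hφ.translate_mem hV (2 * k) h1
    have h3 := (hV.dyadic_mem_iff _ 0 1).2 h2
    rwa [dyadic_zero_dyadic, dyadic_dyadic f (-1) 0 1 (2 * k) k (by norm_num; ring)] at h3
  · refine (hφ.mem_orthogonal_iff _).2 fun l => ?_
    have h1 := (hφ.mem_orthogonal_iff f).1 hf.2 (l - k)
    rw [show dyadic φ 0 l = dyadic (dyadic φ 0 (l - k)) 0 k from
      (dyadic_dyadic φ 0 (l - k) 0 k l (by simp)).symm, inner_dyadic, h1, mul_zero]

theorem IsMRA.dyadic_mem_wavelet_iff (hV : IsMRA V) (f : L2R) (i j : ℤ) :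
    dyadic f j 0 ∈ V (i + 1 + j) ⊓ (V (i + j))ᗮ ↔ f ∈ V (i + 1) ⊓ (V i)ᗮ := by
  rw [Submodule.mem_inf, Submodule.mem_inf, hV.dyadic_mem_iff]
  refine and_congr_right fun _ => ?_
  have hc : (((2 : ℝ) ^ (-j) : ℝ) : ℂ) ≠ 0 := by
    rw [Ne, Complex.ofReal_eq_zero]; positivity
  simp only [Submodule.mem_orthogonal]
  constructor
  · intro h u hu
    have := h (dyadic u j 0) ((hV.dyadic_mem_iff u i j).2 hu)
    rw [inner_dyadic] at this
    exact (mul_eq_zero.1 this).resolve_left hc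
  · intro h u hu
    have := h (dyadic u (-j) 0) ((hV.dyadic_mem_iff _ i j).1 (by rwa [dyadic_cancel']))
    rw [← dyadic_cancel' u j, inner_dyadic, this, mul_zero]

/-- If `f` is orthogonal to each detail space `V (j + 1) ⊓ (V j)ᗮ`, then `f = 0`. -/
theorem IsMRA.eq_zero_of_orthogonal_details (hV : IsMRA V) (f : L2R)
    (h : ∀ j, ∀ g ∈ V (j + 1) ⊓ (V j)ᗮ, (∀ v ∈ V (j + 1) ⊓ (V j)ᗮ, inner ℂ v g = inner ℂ v f) →
      g = 0) : f = 0 := by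
  have hc : ∀ j, CompleteSpace (V j) := fun j => (hV.isClosed j).completeSpace_coe
  have hp : ∀ j, ∀ v ∈ V j, inner ℂ v ((V j).starProjection f) = inner ℂ v f := fun j v hv => by
    have := (V j).starProjection_inner_eq_zero f v hv
    rw [← sub_eq_zero, ← inner_sub_right, ← inner_conj_symm, ← neg_sub f, inner_neg_left, this]
    simp
  -- The difference of consecutive projections is the projection of `f` onto the detail space, which
  -- the hypothesis forces to be zero.
  have hstep : ∀ j, (V (j + 1)).starProjection f = (V j).starProjection f := fun j => by
    rw [← sub_eq_zero]
    have hj : ∀ v ∈ V j, inner ℂ v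
        ((V (j + 1)).starProjection f - (V j).starProjection f) = 0 := fun v hv => by
      rw [inner_sub_right, hp _ v (hV.subset_succ j hv), hp _ v hv, sub_self]
    refine h j _ ⟨?_, ?_⟩ fun v hv => ?_
    · exact sub_mem (Submodule.starProjection_apply_mem _ _)
        (hV.subset_succ j (Submodule.starProjection_apply_mem _ _))
    · exact (Submodule.mem_orthogonal _ _).2 hj
    · rw [inner_sub_right, hp _ v hv.1, Submodule.inner_left_of_mem_orthogonal
        (Submodule.starProjection_apply_mem _ _) hv.2, sub_zero]
  have hconst : ∀ j, (V j).starProjection f = (V 0).starProjection f := fun j => by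
    induction j with
    | zero => rfl
    | succ n ih => rw [hstep, ih]
    | pred n ih => rw [← ih, ← hstep, sub_add_cancel]
  -- The common value of all projections lies in every `V j`, hence is zero; density of the union
  -- then makes `f` orthogonal to everything.
  have hzero : (V 0).starProjection f = 0 := by
    have : (V 0).starProjection f ∈ ⋂ j, (V j : Set L2R) :=
      Set.mem_iInter.2 fun j => hconst j ▸ Submodule.starProjection_apply_mem _ _
    rwa [hV.iInter_eq] at this
  have hclosed : IsClosed {v : L2R | inner ℂ v f = 0} :=
    isClosed_eq (by fun_prop) continuous_const
  have hmem : f ∈ {v : L2R | inner ℂ v f = 0} := by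
    refine closure_minimal (Set.iUnion_subset fun j v hv => ?_) hclosed
      (hV.closure_iUnion_eq ▸ Set.mem_univ f)
    rw [Set.mem_ofPred_eq, ← hp j v hv, hconst, hzero, inner_zero_right]
  exact inner_self_eq_zero.1 hmem

theorem two_rpow_half_mul_self (j : ℤ) :
    (((2 : ℝ) ^ ((j : ℝ) / 2) : ℝ) : ℂ) * (((2 : ℝ) ^ ((j : ℝ) / 2) : ℝ) : ℂ) *
      (((2 : ℝ) ^ (-j) : ℝ) : ℂ) = 1 := by
  rw [← Complex.ofReal_mul, ← Complex.ofReal_mul, ← Real.rpow_add (by norm_num), add_halves,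
    Real.rpow_intCast, zpow_neg, mul_inv_cancel₀ (by positivity), Complex.ofReal_one]

theorem IsWavelet.orthonormal_translates {ψ : L2R} (h : IsWavelet ψ) :
    Orthonormal ℂ fun k : ℤ => dyadic ψ 0 k := by
  have := h.1.comp (fun k : ℤ => ((0 : ℤ), k)) fun a b hab => by simpa using hab
  simp only [Function.comp_def, Int.cast_zero, zero_div, Real.rpow_zero, Complex.ofReal_one] at this
  convert this using 2 with k
  exact (one_smul ℂ _).symm

/-- Different scales lie in mutually orthogonal detail spaces, and dilation carries each of these to
W₀, so orthonormality and completeness need checking only at scale zero. -/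
theorem isWavelet_of_orthonormal_of_complete (hV : IsMRA V) {φ : L2R}
    (hφ : IsScalingFunction V φ) {ψ : L2R} (hψ : ψ ∈ V 1 ⊓ (V 0)ᗮ)
    (ho : Orthonormal ℂ fun k : ℤ => dyadic ψ 0 k)
    (hcompl : ∀ f ∈ V 1 ⊓ (V 0)ᗮ, (∀ k : ℤ, inner ℂ (dyadic ψ 0 k) f = 0) → f = 0) :
    IsWavelet ψ := by
  have hmem : ∀ j k : ℤ, dyadic ψ j k ∈ V (j + 1) ⊓ (V j)ᗮ := fun j k => by
    have h1 := hφ.translate_mem_wavelet hV k hψ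
    have h2 := (hV.dyadic_mem_wavelet_iff _ 0 j).2 h1
    rwa [dyadic_zero_dyadic, zero_add, zero_add, add_comm 1 j] at h2
  have hmono : Monotone V := monotone_int_of_le_succ hV.subset_succ
  have horth : ∀ i j k l : ℤ, i < j → inner ℂ (dyadic ψ i k) (dyadic ψ j l) = 0 :=
    fun i j k l hij => Submodule.inner_right_of_mem_orthogonal
      (hmono (Int.add_one_le_of_lt hij) (hmem i k).1) (hmem j l).2
  refine ⟨?_, ?_⟩
  · rw [orthonormal_iff_ite] at ho ⊢
    rintro ⟨i, k⟩ ⟨j, l⟩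
    simp only [inner_smul_left, inner_smul_right, Complex.conj_ofReal]
    rcases lt_trichotomy i j with hij | rfl | hij
    · rw [horth i j k l hij, if_neg (by simp [hij.ne])]; simp
    · rw [← dyadic_zero_dyadic ψ i k, ← dyadic_zero_dyadic ψ i l, inner_dyadic, ho k l,
        ← mul_assoc, ← mul_assoc, two_rpow_half_mul_self, one_mul]
      simp
    · rw [← inner_conj_symm, horth j i l k hij, if_neg (by simp [hij.ne'])]; simp
  · rw [Submodule.topologicalClosure_eq_top_iff, Submodule.eq_bot_iff]
    intro f hf
    refine hV.eq_zero_of_orthogonal_details f fun j g hg hgf => ?_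
    have hψf : ∀ k, inner ℂ (dyadic ψ j k) f = 0 := fun k => by
      have h1 := Submodule.inner_right_of_mem_orthogonal
        (Submodule.subset_span (Set.mem_range_self (j, k))) hf
      rw [inner_smul_left] at h1
      refine (mul_eq_zero.1 h1).resolve_left ?_
      rw [Complex.conj_ofReal]
      exact Complex.ofReal_ne_zero.2 (by positivity)
    have hg0 : dyadic g (-j) 0 ∈ V 1 ⊓ (V 0)ᗮ := by
      have := (hV.dyadic_mem_wavelet_iff (dyadic g (-j) 0) 0 j).1
        (by rwa [dyadic_cancel', zero_add, zero_add, add_comm 1 j])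
      rwa [zero_add] at this
    have hz := hcompl _ hg0 fun k => by
      have h1 : inner ℂ (dyadic ψ j k) g = 0 := (hgf _ (hmem j k)).trans (hψf k)
      rw [← dyadic_cancel (dyadic ψ 0 k) j, inner_dyadic, dyadic_zero_dyadic, h1, mul_zero]
    rw [← dyadic_cancel' g j, hz]
    exact map_zero (dyadicₗ j 0)

end Hilbert

/-! ### Symbols of V₀, V₁ and the low-pass filter -/

section Symbols

variable {V : ℤ → Submodule ℂ L2R} {φ : L2R}

theorem inner_modulate_fourier (f g : L2R) (n : ℤ) :
    inner ℂ (modulate n (𝓕 f)) (𝓕 g : L2R) = inner ℂ (dyadic f 0 (-n)) g := by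
  rw [← Lp.inner_fourier_eq (dyadic f 0 (-n)) g, fourier_dyadic_zero, neg_neg]

theorem orthonormal_translates_iff (f : L2R) :
    (Orthonormal ℂ fun k : ℤ => dyadic f 0 k) ↔
      ∀ n : ℤ, inner ℂ (modulate n (𝓕 f)) (𝓕 f : L2R) = if n = 0 then 1 else 0 := by
  rw [orthonormal_iff_ite]
  simp only [inner_modulate_fourier]
  constructor
  · intro h n
    simpa using h (-n) 0
  · intro h k l
    have e : dyadic f 0 k = dyadic (dyadic f 0 (k - l)) 0 l :=
      (dyadic_dyadic f 0 (k - l) 0 l k (by simp)).symm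
    rw [e, inner_dyadic, ← neg_sub l k, h (l - k)]
    simp [sub_eq_zero, eq_comm]

theorem IsScalingFunction.periodize_eq (hφ : IsScalingFunction V φ) :
    periodize (𝓕 φ) = haarAddCircle :=
  periodize_eq_haar ((orthonormal_translates_iff φ).1 hφ.2.1)

/-- The isometry sends the characters to the transforms of the translates of φ; each direction
extends this from spanning families to their closed spans. -/
theorem IsScalingFunction.mem_zero_iff (hV : IsMRA V) (hφ : IsScalingFunction V φ) (f : L2R) :
    f ∈ V 0 ↔ ∃ P, (𝓕 f : L2R) = circleMul hφ.periodize_eq P := by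
  constructor
  · intro hf
    have hcl : IsClosed (Set.range (circleMul hφ.periodize_eq)) :=
      (circleMul hφ.periodize_eq).isometry.isClosedEmbedding.isClosed_range
    have := hφ.mem_of_forall
      (S := (LinearMap.range (circleMul hφ.periodize_eq).toLinearMap).comap
        (Lp.fourierTransformₗᵢ ℝ ℂ).toLinearEquiv.toLinearMap)
      (hcl.preimage continuous_fourier_L2)
      (fun k => ⟨fourierLp 2 (-k), (circleMul_fourierLp _ _).trans (fourier_dyadic_zero φ k).symm⟩)
      hf
    obtain ⟨P, hP⟩ := this
    exact ⟨P, hP.symm⟩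
  · rintro ⟨P, hP⟩
    let S := (V 0).comap ((Lp.fourierTransformₗᵢ ℝ ℂ).symm.toLinearEquiv.toLinearMap ∘ₗ
      (circleMul hφ.periodize_eq).toLinearMap)
    have hS : IsClosed (S : Set L2Circle) :=
      (hV.isClosed 0).preimage ((Lp.fourierTransformₗᵢ ℝ ℂ).symm.continuous.comp
        (circleMul hφ.periodize_eq).continuous)
    have hle : (Submodule.span ℂ (Set.range (fourierLp (T := 1) 2))).topologicalClosure ≤ S := by
      refine Submodule.topologicalClosure_minimal _ (Submodule.span_le.2 ?_) hS
      rintro _ ⟨n, rfl⟩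
      change (Lp.fourierTransformₗᵢ ℝ ℂ).symm (circleMul hφ.periodize_eq (fourierLp 2 n)) ∈ V 0
      have h1 : circleMul hφ.periodize_eq (fourierLp 2 n) =
          Lp.fourierTransformₗᵢ ℝ ℂ (dyadic φ 0 (-n)) := by
        rw [circleMul_fourierLp]
        exact (neg_neg n ▸ fourier_dyadic_zero φ (-n)).symm
      rw [h1, LinearIsometryEquiv.symm_apply_apply, ← hφ.2.2]
      exact Submodule.le_topologicalClosure _ (Submodule.subset_span ⟨-n, rfl⟩)
    rw [span_fourierLp_closure_eq_top (p := 2) ENNReal.ofNat_ne_top] at hle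
    have h2 : (Lp.fourierTransformₗᵢ ℝ ℂ).symm (circleMul hφ.periodize_eq P) ∈ V 0 :=
      hle (Submodule.mem_top (x := P))
    rwa [← hP, show (𝓕 f : L2R) = Lp.fourierTransformₗᵢ ℝ ℂ f from rfl,
      LinearIsometryEquiv.symm_apply_apply] at h2

theorem IsScalingFunction.mem_one_iff (hV : IsMRA V) (hφ : IsScalingFunction V φ) (f : L2R) :
    f ∈ V 1 ↔ ∃ P, dyadic (𝓕 f) 1 0 = circleMul hφ.periodize_eq P := by
  have h1 := hV.dyadic_mem_iff f 1 (-1)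
  rw [← h1, add_neg_cancel, hφ.mem_zero_iff hV, fourier_dyadic_neg_one]
  constructor
  · rintro ⟨P, hP⟩
    exact ⟨(2 : ℂ)⁻¹ • P, by rw [map_smul, ← hP, inv_smul_smul₀ two_ne_zero]⟩
  · rintro ⟨P, hP⟩
    exact ⟨(2 : ℂ) • P, by rw [map_smul, ← hP]⟩

/-- The low-pass filter is the symbol of the scaling function: `φ̂(2ξ) = m₀(ξ) φ̂(ξ)`. -/
theorem IsLowPassFilter.exists_symbol (hφ : IsScalingFunction V φ) {m₀ : ℝ → ℂ}
    (hm : IsLowPassFilter φ m₀) :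
    ∃ M, dyadic (𝓕 φ) 1 0 = circleMul hφ.periodize_eq M ∧
      ∀ᵐ ξ : ℝ, M (ξ : UnitAddCircle) = m₀ ξ := by
  obtain ⟨α, hα, hlim⟩ := hm.exists_coeff
  obtain ⟨M, hM, hMm⟩ := exists_circle_of_periodic hm.periodic hm.memLp
  refine ⟨hM.toLp, ?_, ?_⟩
  swap
  · filter_upwards [ae_coe_of_ae hM.coeFn_toLp] with ξ h1
    rw [h1, hMm]
  have hs : HasSum (fun k : ℤ => (((1 / √2 : ℝ) : ℂ) * α k) • fourierLp (T := 1) 2 (-k))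
      hM.toLp := by
    rw [HasSum, Lp.tendsto_Lp_iff_tendsto_eLpNorm']
    refine hlim.congr fun s => ?_
    have hae : (⇑(∑ k ∈ s, (((1 / √2 : ℝ) : ℂ) * α k) • fourierLp (T := 1) 2 (-k)) -
        ⇑(hM.toLp) : UnitAddCircle → ℂ) =ᵐ[haarAddCircle]
        fun x => ∑ k ∈ s, (((1 / √2 : ℝ) : ℂ) * α k) * fourier (-k) x - M x := by
      have h1 : ∀ᵐ x ∂haarAddCircle, ∀ k : ℤ,
          ((((1 / √2 : ℝ) : ℂ) * α k) • fourierLp (T := 1) 2 (-k) : Lp ℂ 2 haarAddCircle) x =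
            (((1 / √2 : ℝ) : ℂ) * α k) * fourier (-k) x := by
        rw [ae_all_iff]
        intro k
        filter_upwards [Lp.coeFn_smul (((1 / √2 : ℝ) : ℂ) * α k) (fourierLp (T := 1) 2 (-k)),
          coeFn_fourierLp (T := 1) 2 (-k)] with x h2 h3
        rw [h2, Pi.smul_apply, h3, smul_eq_mul]
      filter_upwards [h1, hM.coeFn_toLp, Lp.coeFn_finsetSum s
        (fun k => (((1 / √2 : ℝ) : ℂ) * α k) • fourierLp (T := 1) 2 (-k))] with x h2 h3 h4
      rw [Pi.sub_apply, h3, h4, Finset.sum_apply]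
      simp only [h2]
    have hcont : AEStronglyMeasurable
        (fun x => ∑ k ∈ s, (((1 / √2 : ℝ) : ℂ) * α k) * fourier (-k) x - M x)
        (haarAddCircle : Measure UnitAddCircle) :=
      (Continuous.aestronglyMeasurable (by fun_prop)).sub hM.aestronglyMeasurable
    rw [eLpNorm_congr_ae hae,
      ← eLpNorm_comp_measurePreserving hcont (measurePreserving_coe_Ioc 0), zero_add,
      restrict_Ioc_eq_restrict_Icc]
    refine eLpNorm_congr_norm_ae (Eventually.of_forall fun ξ => ?_)
    rw [Function.comp_apply, hMm, ← norm_neg, neg_sub, Finset.mul_sum]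
    congr 2
    refine Finset.sum_congr rfl fun k _ => ?_
    have he : 2 * (Real.pi : ℂ) * Complex.I * ((-k : ℤ) : ℂ) * ξ / ((1 : ℝ) : ℂ) =
        -2 * Real.pi * Complex.I * k * ξ := by
      push_cast
      ring
    rw [fourier_coe_apply, he, mul_assoc (((1 / √2 : ℝ) : ℂ))]
  set c : ℂ := ((1 / √2 : ℝ) : ℂ) with hc
  -- One 1/√2 comes from the definition of m₀, one from the refinement equation, and the 2 from the
  -- transform of φ(x/2).
  have hcc : c * c * 2 = 1 := by
    rw [hc, ← Complex.ofReal_mul, div_mul_div_comm, Real.mul_self_sqrt zero_le_two]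
    norm_num
  have h1 : HasSum (fun k => (c * α k) • modulate (-k) (𝓕 φ))
      (circleMul hφ.periodize_eq hM.toLp) := by
    have := hs.mapL (circleMul hφ.periodize_eq).toContinuousLinearMap
    refine this.congr_fun fun k => ?_
    rw [LinearIsometry.coe_toContinuousLinearMap, map_smul, circleMul_fourierLp]
  have h2 : HasSum (fun k => (c * α k) • modulate (-k) (𝓕 φ)) (dyadic (𝓕 φ) 1 0) := by
    have := (hα.const_smul c).mapL
      (Lp.fourierTransformₗᵢ ℝ ℂ).toContinuousLinearEquiv.toContinuousLinearMap
    have e : ∀ f : L2R, (Lp.fourierTransformₗᵢ ℝ ℂ).toContinuousLinearEquiv.toContinuousLinearMap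
        f = 𝓕 f := fun f => rfl
    have es : ∀ (z : ℂ) (f : L2R), (𝓕 (z • f) : L2R) = z • 𝓕 f :=
      (Lp.fourierTransformₗᵢ ℝ ℂ).map_smul
    simp only [e, es, fourier_dyadic_zero, fourier_dyadic_neg_one, smul_smul] at this
    rwa [hcc, one_smul] at this
  exact h2.unique h1

/-! ### Bracket identities and the structure of W₀ -/

theorem ae_shift {p : UnitAddCircle → Prop} (h : ∀ᵐ x ∂haarAddCircle, p x) :
    ∀ᵐ x ∂haarAddCircle, p (x + halfPeriod) :=
  measurePreserving_add_halfPeriod.quasiMeasurePreserving.ae h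

theorem add_halfPeriod_add_halfPeriod (x : UnitAddCircle) : x + halfPeriod + halfPeriod = x := by
  rw [add_assoc, halfPeriod_add_halfPeriod, add_zero]

variable (hφ : IsScalingFunction V φ)

theorem IsScalingFunction.symbol_gram {M : L2Circle} (hM : dyadic (𝓕 φ) 1 0 = circleMul hφ.periodize_eq M) :
    ∀ᵐ x ∂haarAddCircle,
      conj (M x) * M x + conj (M (x + halfPeriod)) * M (x + halfPeriod) = 1 :=
  (inner_modulate_iff _ hM hM 1).1 ((orthonormal_translates_iff φ).1 hφ.2.1)

theorem IsScalingFunction.mem_orthogonal_iff_symbol {M A : L2Circle} {f : L2R}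
    (hM : dyadic (𝓕 φ) 1 0 = circleMul hφ.periodize_eq M)
    (hA : dyadic (𝓕 f) 1 0 = circleMul hφ.periodize_eq A) :
    f ∈ (V 0)ᗮ ↔ ∀ᵐ x ∂haarAddCircle,
      conj (M x) * A x + conj (M (x + halfPeriod)) * A (x + halfPeriod) = 0 := by
  rw [← inner_modulate_iff _ hM hA 0, hφ.mem_orthogonal_iff]
  simp only [inner_modulate_fourier, ite_self]
  exact ⟨fun h n => h (-n), fun h k => by simpa using h (-k)⟩

/-- The quotient of the symbol `A` of a detail function by the conjugate shifted filter. -/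
def detailSymbol (M A : UnitAddCircle → ℂ) (x : UnitAddCircle) : ℂ :=
  A x * M (x + halfPeriod) - A (x + halfPeriod) * M x

/-- The sign change holds at every point, not only a.e., so the ν built from it is exactly periodic.
-/
theorem detailSymbol_add_halfPeriod (M A : UnitAddCircle → ℂ) (x : UnitAddCircle) :
    detailSymbol M A (x + halfPeriod) = -detailSymbol M A x := by
  simp only [detailSymbol, add_halfPeriod_add_halfPeriod]
  ring

theorem measurable_detailSymbol {M A : UnitAddCircle → ℂ} (hM : Measurable M) (hA : Measurable A) :
    Measurable (detailSymbol M A) := by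
  unfold detailSymbol
  have := measurePreserving_add_halfPeriod.measurable
  exact (hA.mul (hM.comp this)).sub ((hA.comp this).mul hM)

/-- The vector (A(x), A(x + 1/2)) is orthogonal to the unit vector (M(x), M(x + 1/2)) in ℂ², hence a
multiple of (conj M(x + 1/2), -conj M(x)); the multiplier is a 2 × 2 determinant. -/
theorem IsScalingFunction.eq_detailSymbol_mul {M A : L2Circle} {f : L2R}
    (hM : dyadic (𝓕 φ) 1 0 = circleMul hφ.periodize_eq M)
    (hA : dyadic (𝓕 f) 1 0 = circleMul hφ.periodize_eq A) (hf : f ∈ (V 0)ᗮ) :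
    ∀ᵐ x ∂haarAddCircle, A x = detailSymbol M A x * conj (M (x + halfPeriod)) := by
  filter_upwards [hφ.symbol_gram hM, (hφ.mem_orthogonal_iff_symbol hM hA).1 hf] with x h1 h2
  rw [detailSymbol]
  linear_combination -A x * h1 + M x * h2

/-- Two symbols of the form `L · conj M(· + 1/2)`, with `L` anti-invariant under the half-period
shift, have bracket product `conj L₁ · L₂`. -/
theorem IsScalingFunction.bracket_eq {M A B : L2Circle} {L K : UnitAddCircle → ℂ}
    (hM : dyadic (𝓕 φ) 1 0 = circleMul hφ.periodize_eq M)
    (hL : ∀ x, L (x + halfPeriod) = -L x) (hK : ∀ x, K (x + halfPeriod) = -K x)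
    (hA : ∀ᵐ x ∂haarAddCircle, A x = L x * conj (M (x + halfPeriod)))
    (hB : ∀ᵐ x ∂haarAddCircle, B x = K x * conj (M (x + halfPeriod))) :
    ∀ᵐ x ∂haarAddCircle, conj (A x) * B x + conj (A (x + halfPeriod)) * B (x + halfPeriod) =
      conj (L x) * K x := by
  filter_upwards [hφ.symbol_gram hM, hA, hB, ae_shift hA, ae_shift hB] with x h1 h2 h3 h4 h5
  rw [h2, h3, h4, h5, add_halfPeriod_add_halfPeriod, hL, hK]
  simp only [map_mul, map_neg, Complex.conj_conj]
  linear_combination conj (L x) * K x * h1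

theorem conj_mul_self_eq_one_iff (z : ℂ) : conj z * z = 1 ↔ ‖z‖ = 1 := by
  rw [Complex.conj_mul', ← Complex.ofReal_pow, Complex.ofReal_eq_one,
    pow_eq_one_iff_of_nonneg (norm_nonneg z) two_ne_zero]

theorem IsScalingFunction.orthonormal_iff_symbol {M A : L2Circle} {L : UnitAddCircle → ℂ} {ψ : L2R}
    (hM : dyadic (𝓕 φ) 1 0 = circleMul hφ.periodize_eq M)
    (hA : dyadic (𝓕 ψ) 1 0 = circleMul hφ.periodize_eq A)
    (hL : ∀ x, L (x + halfPeriod) = -L x)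
    (hAL : ∀ᵐ x ∂haarAddCircle, A x = L x * conj (M (x + halfPeriod))) :
    (Orthonormal ℂ fun k : ℤ => dyadic ψ 0 k) ↔ ∀ᵐ x ∂haarAddCircle, ‖L x‖ = 1 := by
  rw [orthonormal_translates_iff, inner_modulate_iff _ hA hA 1]
  refine eventually_congr ?_
  filter_upwards [hφ.bracket_eq hM hL hL hAL hAL] with x hx
  rw [hx, conj_mul_self_eq_one_iff]

theorem IsScalingFunction.isWavelet_iff_symbol (hV : IsMRA V) {M A : L2Circle} {L : UnitAddCircle → ℂ}
    {ψ : L2R} (hψ : ψ ∈ V 1 ⊓ (V 0)ᗮ)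
    (hM : dyadic (𝓕 φ) 1 0 = circleMul hφ.periodize_eq M)
    (hA : dyadic (𝓕 ψ) 1 0 = circleMul hφ.periodize_eq A)
    (hL : ∀ x, L (x + halfPeriod) = -L x)
    (hAL : ∀ᵐ x ∂haarAddCircle, A x = L x * conj (M (x + halfPeriod))) :
    IsWavelet ψ ↔ ∀ᵐ x ∂haarAddCircle, ‖L x‖ = 1 := by
  rw [← hφ.orthonormal_iff_symbol hM hA hL hAL]
  refine ⟨IsWavelet.orthonormal_translates, fun ho => ?_⟩
  refine isWavelet_of_orthonormal_of_complete hV hφ hψ ho fun f hf hin => ?_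
  obtain ⟨F, hF⟩ := (hφ.mem_one_iff hV f).1 hf.1
  have hFL := hφ.eq_detailSymbol_mul hM hF hf.2
  have hz := (inner_modulate_iff _ hA hF 0).1 fun n => by
    rw [inner_modulate_fourier, hin, ite_self]
  -- The bracket of the symbols of ψ and `f` is conj L times the detail symbol of `f`. It vanishes
  -- while |L| = 1, so the detail symbol is zero, and `F` with it.
  have hF0 : F = 0 := by
    refine Lp.ext ?_
    filter_upwards [hz, hFL, hφ.bracket_eq hM hL (detailSymbol_add_halfPeriod M F) hAL hFL,
      (hφ.orthonormal_iff_symbol hM hA hL hAL).1 ho, Lp.coeFn_zero ℂ 2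
        (haarAddCircle : Measure UnitAddCircle)] with x h1 h2 h3 h4 h5
    have h6 : conj (L x) ≠ 0 := by
      rw [← norm_ne_zero_iff, RCLike.norm_conj, h4]
      exact one_ne_zero
    rw [h2, (mul_eq_zero.1 (h3.symm.trans h1)).resolve_left h6, h5, zero_mul, Pi.zero_apply]
  rw [hF0, map_zero, ← norm_eq_zero, norm_dyadic, Lp.norm_fourier_eq, mul_eq_zero] at hF
  exact norm_eq_zero.1 (hF.resolve_left (by positivity))

/-! ### Translating symbols into formulas on the line -/

variable {m₀ : ℝ → ℂ}

theorem ae_symbol_shift {M : UnitAddCircle → ℂ} (hm : ∀ᵐ ξ : ℝ, M (ξ : UnitAddCircle) = m₀ ξ) :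
    ∀ᵐ ξ : ℝ, M ((ξ : UnitAddCircle) + halfPeriod) = m₀ (ξ + 1 / 2) := by
  filter_upwards [(measurePreserving_add_right volume (1 / 2 : ℝ)).quasiMeasurePreserving.ae hm]
    with ξ h
  rw [← h, halfPeriod, AddCircle.coe_add]

theorem ae_dyadic_one (f : L2R) : ∀ᵐ ξ : ℝ, dyadic f 1 0 ξ = f (2 * ξ) := by
  filter_upwards [coeFn_dyadic f 1 0] with ξ h
  simpa using h

theorem memLp_mul_conj_shift {L : UnitAddCircle → ℂ} (M : L2Circle)
    (hL : AEStronglyMeasurable L haarAddCircle) (hL1 : ∀ᵐ x ∂haarAddCircle, ‖L x‖ = 1) :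
    MemLp (fun x => L x * conj (M (x + halfPeriod))) 2 haarAddCircle := by
  have h1 : MemLp (fun x => M (x + halfPeriod)) 2 haarAddCircle :=
    (Lp.memLp M).comp_measurePreserving measurePreserving_add_halfPeriod
  refine h1.of_le (hL.mul (Complex.continuous_conj.comp_aestronglyMeasurable
    h1.aestronglyMeasurable)) ?_
  filter_upwards [hL1] with x hx
  rw [norm_mul, hx, one_mul, RCLike.norm_conj]

/-- The symbol of `ψ` gives the formula for `ψ̂(2ξ)` on the line. -/
theorem IsScalingFunction.formula_of_symbol {M A : L2Circle} {L : UnitAddCircle → ℂ} {ψ : L2R}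
    (hm : ∀ᵐ ξ : ℝ, M (ξ : UnitAddCircle) = m₀ ξ)
    (hA : dyadic (𝓕 ψ) 1 0 = circleMul hφ.periodize_eq A)
    (hAL : ∀ᵐ x ∂haarAddCircle, A x = L x * conj (M (x + halfPeriod))) :
    ∀ᵐ ξ : ℝ, (𝓕 ψ : L2R) (2 * ξ) = L ξ * conj (m₀ (ξ + 1 / 2)) * (𝓕 φ : L2R) ξ := by
  filter_upwards [ae_dyadic_one (𝓕 ψ), ae_symbol_shift hm,
    coeFn_circleMul hφ.periodize_eq hAL] with ξ h1 h2 h3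
  rw [← h1, ← h2, hA, h3]

/-- The formula for `ψ̂(2ξ)` on the line determines the symbol of `ψ`. -/
theorem IsScalingFunction.symbol_of_formula {M A : L2Circle} {L : UnitAddCircle → ℂ} {ψ : L2R}
    (hm : ∀ᵐ ξ : ℝ, M (ξ : UnitAddCircle) = m₀ ξ)
    (hA : dyadic (𝓕 ψ) 1 0 = circleMul hφ.periodize_eq A)
    (hL : AEStronglyMeasurable L haarAddCircle) (hL1 : ∀ᵐ x ∂haarAddCircle, ‖L x‖ = 1)
    (hf : ∀ᵐ ξ : ℝ,
      (𝓕 ψ : L2R) (2 * ξ) = L ξ * conj (m₀ (ξ + 1 / 2)) * (𝓕 φ : L2R) ξ) :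
    ∀ᵐ x ∂haarAddCircle, A x = L x * conj (M (x + halfPeriod)) := by
  have hmem := memLp_mul_conj_shift M hL hL1
  have hAB : A = hmem.toLp := by
    -- Injectivity of the isometry replaces division by φ̂, which may vanish on a set of positive
    -- measure.
    refine (circleMul hφ.periodize_eq).injective (hA.symm.trans (Lp.ext ?_))
    filter_upwards [ae_dyadic_one (𝓕 ψ), ae_symbol_shift hm, hf,
      coeFn_circleMul hφ.periodize_eq hmem.coeFn_toLp] with ξ h1 h2 h3 h4
    rw [h1, h3, h4, h2]
  rw [hAB]
  exact hmem.coeFn_toLp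

/-- Every unimodular `L`, anti-invariant under the half-period shift, is realised by a wavelet. -/
theorem IsScalingFunction.exists_wavelet_of_symbol (hV : IsMRA V) {M : L2Circle}
    {L : UnitAddCircle → ℂ} (hM : dyadic (𝓕 φ) 1 0 = circleMul hφ.periodize_eq M)
    (hm : ∀ᵐ ξ : ℝ, M (ξ : UnitAddCircle) = m₀ ξ)
    (hLm : AEStronglyMeasurable L haarAddCircle) (hL : ∀ x, L (x + halfPeriod) = -L x)
    (hL1 : ∀ᵐ x ∂haarAddCircle, ‖L x‖ = 1) :
    ∃ ψ : L2R, ψ ∈ V 1 ⊓ (V 0)ᗮ ∧ IsWavelet ψ ∧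
      ∀ᵐ ξ : ℝ, (𝓕 ψ : L2R) (2 * ξ) = L ξ * conj (m₀ (ξ + 1 / 2)) * (𝓕 φ : L2R) ξ := by
  have hmem := memLp_mul_conj_shift M hLm hL1
  have hAL := hmem.coeFn_toLp
  let ψ : L2R := (Lp.fourierTransformₗᵢ ℝ ℂ).symm
    (dyadic (circleMul hφ.periodize_eq hmem.toLp) (-1) 0)
  have hA : dyadic (𝓕 ψ) 1 0 = circleMul hφ.periodize_eq hmem.toLp := by
    rw [show (𝓕 ψ : L2R) = dyadic (circleMul hφ.periodize_eq hmem.toLp) (-1) 0 from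
      LinearIsometryEquiv.apply_symm_apply _ _, dyadic_cancel']
  have hψ : ψ ∈ V 1 ⊓ (V 0)ᗮ := by
    refine ⟨(hφ.mem_one_iff hV ψ).2 ⟨_, hA⟩, (hφ.mem_orthogonal_iff_symbol hM hA).2 ?_⟩
    filter_upwards [hAL, ae_shift hAL] with x h1 h2
    rw [h1, h2, hL, add_halfPeriod_add_halfPeriod]
    ring
  exact ⟨ψ, hψ, (hφ.isWavelet_iff_symbol hV hψ hM hA hL hAL).2 hL1,
    hφ.formula_of_symbol hm hA hAL⟩

theorem memLp_of_unimodular {ν : ℝ → ℂ} (hmeas : Measurable ν) (hnorm : ∀ᵐ ξ : ℝ, ‖ν ξ‖ = 1) :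
    MemLp ν 2 (volume.restrict (Set.Icc 0 1)) :=
  MemLp.of_bound hmeas.aestronglyMeasurable 1
    (ae_restrict_of_ae (hnorm.mono fun _ h => h.le))

/-- A function on the circle, anti-invariant under the half-period shift, has the form
`e^{2πiξ} ν(2ξ)` with `ν` of period `1`. -/
theorem exists_periodic_of_antiinvariant {L : UnitAddCircle → ℂ} (hLm : Measurable L)
    (hL : ∀ x, L (x + halfPeriod) = -L x) (hL1 : ∀ᵐ x ∂haarAddCircle, ‖L x‖ = 1) :
    ∃ ν : ℝ → ℂ, Function.Periodic ν 1 ∧ Measurable ν ∧ (∀ᵐ ξ : ℝ, ‖ν ξ‖ = 1) ∧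
      ∀ ξ : ℝ, L ξ = Complex.exp (2 * Real.pi * Complex.I * ξ) * ν (2 * ξ) := by
  -- Solving for ν with η = 2ξ forces this choice. Under η ↦ η + 1 both factors change sign, so the
  -- period is 1.
  refine ⟨fun η => Complex.exp (-(Real.pi * η) * Complex.I) * L ((η / 2 : ℝ) : UnitAddCircle),
    fun η => ?_, ?_, ?_, fun ξ => ?_⟩
  · have h1 : (((η + 1) / 2 : ℝ) : UnitAddCircle) = ((η / 2 : ℝ) : UnitAddCircle) + halfPeriod := by
      rw [halfPeriod, ← AddCircle.coe_add, add_div]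
    have h2 : -((Real.pi : ℂ) * ((η + 1 : ℝ) : ℂ)) * Complex.I =
        -(Real.pi * η) * Complex.I - Real.pi * Complex.I := by
      push_cast
      ring
    simp only [h1, h2, hL, Complex.exp_sub_pi_mul_I]
    ring
  · exact Measurable.mul (by fun_prop)
      (hLm.comp (AddCircle.measurable_mk'.comp (measurable_id.div_const 2)))
  · have := (quasiMeasurePreserving_affine (a := 1 / 2) (by norm_num) 0).ae (ae_coe_of_ae hL1)
    filter_upwards [this] with η hη
    rw [norm_mul, show -((Real.pi : ℂ) * η) * Complex.I = ((-(Real.pi * η) : ℝ) : ℂ) * Complex.I by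
      push_cast; ring, Complex.norm_exp_ofReal_mul_I, one_mul]
    rwa [sub_zero, one_div_mul_eq_div] at hη
  · simp only [mul_div_cancel_left₀ ξ (two_ne_zero' ℝ)]
    rw [← mul_assoc, ← Complex.exp_add]
    have : 2 * (Real.pi : ℂ) * Complex.I * ξ + -(Real.pi * ((2 * ξ : ℝ) : ℂ)) * Complex.I = 0 := by
      push_cast
      ring
    rw [this, Complex.exp_zero, one_mul]

/-- Conversely, `e^{2πiξ} ν(2ξ)` with `ν` of period `1` descends to the circle and is anti-invariant
under the half-period shift. -/
theorem exists_antiinvariant_of_periodic {ν : ℝ → ℂ} (hper : Function.Periodic ν 1)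
    (hmeas : Measurable ν) (hnorm : ∀ᵐ ξ : ℝ, ‖ν ξ‖ = 1) :
    ∃ L : UnitAddCircle → ℂ, AEStronglyMeasurable L haarAddCircle ∧
      (∀ x, L (x + halfPeriod) = -L x) ∧ (∀ᵐ x ∂haarAddCircle, ‖L x‖ = 1) ∧
      ∀ ξ : ℝ, L ξ = Complex.exp (2 * Real.pi * Complex.I * ξ) * ν (2 * ξ) := by
  set l : ℝ → ℂ := fun ξ => Complex.exp (2 * Real.pi * Complex.I * ξ) * ν (2 * ξ) with hl
  have hanti : ∀ ξ, l (ξ + 1 / 2) = -l ξ := fun ξ => by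
    have h1 : 2 * (Real.pi : ℂ) * Complex.I * ((ξ + 1 / 2 : ℝ) : ℂ) =
        2 * Real.pi * Complex.I * ξ + Real.pi * Complex.I := by
      push_cast
      ring
    have h2 : 2 * (ξ + 1 / 2) = 2 * ξ + 1 := by ring
    simp only [hl, h1, h2, Complex.exp_add_pi_mul_I, hper (2 * ξ), neg_mul]
  have hlper : Function.Periodic l 1 := fun ξ => by
    rw [← neg_neg (l ξ), ← hanti, ← hanti, add_assoc, add_halves]
  have hlmeas : Measurable l := by
    have : Measurable fun ξ : ℝ => ν (2 * ξ) := hmeas.comp (measurable_const_mul 2)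
    exact Measurable.mul (by fun_prop) this
  have hlnorm : ∀ᵐ ξ : ℝ, ‖l ξ‖ = 1 := by
    filter_upwards [(quasiMeasurePreserving_affine (a := 2) two_ne_zero 0).ae hnorm] with ξ h
    rw [sub_zero] at h
    rw [hl, norm_mul, h, mul_one, show 2 * (Real.pi : ℂ) * Complex.I * ξ =
      ((2 * Real.pi * ξ : ℝ) : ℂ) * Complex.I by push_cast; ring, Complex.norm_exp_ofReal_mul_I]
  obtain ⟨L, hLmem, hL⟩ := exists_circle_of_periodic hlper (memLp_of_unimodular hlmeas hlnorm)
  refine ⟨L, hLmem.aestronglyMeasurable, fun x => ?_, ?_, hL⟩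
  · induction x using QuotientAddGroup.induction_on with
    | H ξ =>
      have h1 := hL (ξ + 1 / 2)
      rw [hanti, ← hL, AddCircle.coe_add] at h1
      exact h1
  · refine ae_of_ae_coe ?_
    filter_upwards [hlnorm] with ξ h
    rw [hL, h]

end Symbols

end MRAWavelet

end

theorem proposition14
    (V : ℤ → Submodule ℂ L2R) (hV : IsMRA V)
    (φ : L2R) (hφ : IsScalingFunction V φ)
    (m₀ : ℝ → ℂ) (hm₀ : IsLowPassFilter φ m₀) :
    (∀ ψ : L2R, ψ ∈ V 1 ⊓ (V 0)ᗮ →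
      (IsWavelet ψ ↔
        ∃ ν : ℝ → ℂ, Function.Periodic ν 1 ∧ Measurable ν ∧
          MemLp ν 2 (volume.restrict (Set.Icc 0 1)) ∧
          (∀ᵐ ξ : ℝ, ‖ν ξ‖ = 1) ∧
          ∀ᵐ ξ : ℝ, (𝓕 ψ : L2R) (2 * ξ) =
            Complex.exp (2 * Real.pi * Complex.I * ξ) * ν (2 * ξ) *
              conj (m₀ (ξ + 1 / 2)) * (𝓕 φ : L2R) ξ)) ∧
    (∃ ψ : L2R, ψ ∈ V 1 ⊓ (V 0)ᗮ ∧ IsWavelet ψ ∧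
      ∀ᵐ ξ : ℝ, (𝓕 ψ : L2R) (2 * ξ) =
        Complex.exp (2 * Real.pi * Complex.I * ξ) *
          conj (m₀ (ξ + 1 / 2)) * (𝓕 φ : L2R) ξ) := by
  obtain ⟨M, hM, hm⟩ := hm₀.exists_symbol hφ
  refine ⟨fun ψ hψ => ?_, ?_⟩
  · obtain ⟨A, hA⟩ := (hφ.mem_one_iff hV ψ).1 hψ.1
    constructor
    · intro hw
      have hAL := hφ.eq_detailSymbol_mul hM hA hψ.2
      have hL1 := (hφ.isWavelet_iff_symbol hV hψ hM hA
        (detailSymbol_add_halfPeriod M A) hAL).1 hw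
      obtain ⟨ν, hper, hmeas, hnorm, hν⟩ := exists_periodic_of_antiinvariant
        (measurable_detailSymbol (Lp.stronglyMeasurable M).measurable
          (Lp.stronglyMeasurable A).measurable) (detailSymbol_add_halfPeriod M A) hL1
      refine ⟨ν, hper, hmeas, memLp_of_unimodular hmeas hnorm, hnorm, ?_⟩
      filter_upwards [hφ.formula_of_symbol hm hA hAL] with ξ hξ
      rw [hξ, hν]
    · rintro ⟨ν, hper, hmeas, -, hnorm, hν⟩
      obtain ⟨L, hLm, hL, hL1, hLν⟩ := exists_antiinvariant_of_periodic hper hmeas hnorm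
      refine (hφ.isWavelet_iff_symbol hV hψ hM hA hL
        (hφ.symbol_of_formula hm hA hLm hL1 ?_)).2 hL1
      filter_upwards [hν] with ξ hξ
      rw [hξ, hLν]
  -- The choice ν ≡ 1 is L = e^{2πiξ}, the character of frequency 1, anti-invariant since 1 is odd.
  · obtain ⟨ψ, hψ, hw, hf⟩ := hφ.exists_wavelet_of_symbol hV (L := fourier 1) hM hm
      (fourier 1).continuous.aestronglyMeasurable
      (fun x => by rw [fourier_add_halfPeriod]; simp)
      (Eventually.of_forall fun x => norm_fourier_apply 1 x)
    refine ⟨ψ, hψ, hw, ?_⟩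
    filter_upwards [hf] with ξ hξ
    rw [hξ, fourier_coe_apply]
    simp
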